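/- Let $x_1,\dots,x_n\in\mathbb R^p$ and $y_1,\dots,y_n\in\mathbb R$, and consider the generalized linear model with canonical link and cumulant generating function $\Phi:\mathbb R\to\mathbb R$, that is, the unconstrained minimization over $\theta\in\mathbb R^p$ of $$f(\theta)=\frac1n\sum_{i=1}^n f_i(\theta),\qquad f_i(\theta)=\Phi(\langle x_i,\theta\rangle)-y_i\langle x_i,\theta\rangle .$$ Assume that $\Phi$ is twice continuously differentiable with $0\le\Phi''\le 1$ (in particular $\Phi$ is convex), that $\Phi''$ is Lipschitz continuous with constant $L$, and that $\max_i\|x_i\|_2\le\sqrt{R_x}$. Let $\mathcal C\subset\mathbb R^p$ be closed and convex, with Euclidean projection $\mathcal P_{\mathcal C}$, and let $\theta_*\in\mathcal C$ be a minimizer of $f$ over $\mathbb R^p$. Fix a rank threshold $0\le r<p$, an initial point $\hat\theta^0\in\mathbb R^p$ and sub-sample sizes $|S_t|\ge 1$. For $t=0,1,2,\dots$ let $S_t$ be a sample of $|S_t|$ indices drawn uniformly from $\{1,\dots,n\}$, with or without replacement, independently for different $t$. Put $H_{S_t}(\theta)=\frac1{|S_t|}\sum_{i\in S_t}\nabla^2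 f_i(\theta)$ (indices counted with multiplicity), let $\lambda_1^t\ge\dots\ge\lambda_p^t\ge0$ be the eigenvalues of $H_{S_t}(\hat\theta^t)$, with orthonormal eigenvectors $u_1^t,\dots,u_p^t$, and let the NewSamp iterates with step size $\eta_t=1$ be $$\hat\theta^{t+1}=\mathcal P_{\mathcal C}\bigl(\hat\theta^t-Q^t\nabla f(\hat\theta^t)\bigr),\qquad Q^t=\frac1{\lambda_{r+1}^t}I+\sum_{i=1}^r\Bigl(\frac1{\lambda_i^t}-\frac1{\lambda_{r+1}^t}\Bigr)u_i^t(u_i^t)^{\top}.$$ This requires $\lambda_{r+1}^t>0$; if $\lambda_{r+1}^t=0$, the iterate is left unchanged, $\hat\theta^{t+1}=\hat\theta^t$. Then there is an absolute constant $c>0$ (independent of all of the above data) such that, for every $t\ge0$, with probability at least $1-2/p$ the following holds: if $\lambda_{r+1}^t>0$, then $$\|\hat\theta^{t+1}-\theta_*\|_2\le\xi_1^t\,\|\hat\theta^t-\theta_*\|_2+\xi_2^t\,\|\hat\theta^t-\theta_*\|_2^2,$$ where $$\xi_1^t=1-\frac{\lambda_p^t}{\lambda_{r+1}^t}+\frac{cR_x}{\lambda_{r+1}^t}\sqrt{\frac{\log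 p}{|S_t|}},\qquad \xi_2^t=\frac{L\,R_x^{3/2}}{2\lambda_{r+1}^t}.$$ -/

import Mathlib

open MeasureTheory ProbabilityTheory
open scoped NNReal Gradient

noncomputable section

namespace NewSamp

/-- The parameter space `ℝ^p` with its Euclidean norm. -/
abbrev Param (p : ℕ) : Type := EuclideanSpace ℝ (Fin p)

/-- The Hessian of `g` at `θ`, as a linear operator: the derivative of the gradient. -/
def hessian {p : ℕ} (g : Param p → ℝ) (θ : Param p) : Param p →L[ℝ] Param p :=
  fderiv ℝ (∇ g) θ

/-- The average `f = (1/n) ∑ᵢ fᵢ`. -/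
def average {p n : ℕ} (f : Fin n → Param p → ℝ) (θ : Param p) : ℝ :=
  (1 / (n : ℝ)) * ∑ i, f i θ

/-- The sub-sampled Hessian `H_S(θ) = (1/|S|) ∑_{i ∈ S} ∇² fᵢ(θ)`. A sub-sample of size `m` is
given by the indices `s 0, …, s (m - 1)` in the order in which they are drawn. -/
def subHessian {p n m : ℕ} (f : Fin n → Param p → ℝ) (s : Fin m → Fin n) (θ : Param p) :
    Param p →L[ℝ] Param p :=
  (1 / (m : ℝ)) • ∑ j, hessian (f (s j)) θ

open Classical in
/-- The eigenvalues of a symmetric operator on `ℝ^p`, with multiplicity, in decreasing order.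
The index starts from `0`: the `i`-th largest eigenvalue is the one at index `i - 1`.
(The value is `0` if the operator is not symmetric.) -/
def eigenvalue {p : ℕ} (A : Param p →L[ℝ] Param p) (i : Fin p) : ℝ :=
  if h : (A : Param p →ₗ[ℝ] Param p).IsSymmetric then
    h.eigenvalues finrank_euclideanSpace_fin i
  else 0

open Classical in
/-- Orthonormal eigenvectors of a symmetric operator, matching `eigenvalue`. -/
def eigenvector {p : ℕ} (A : Param p →L[ℝ] Param p) (i : Fin p) : Param p :=
  if h : (A : Param p →ₗ[ℝ] Param p).IsSymmetric then
    h.eigenvectorBasis finrank_euclideanSpace_fin i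
  else 0

/-- The scaling matrix of rank threshold `r`, with `λ₁ ≥ λ₂ ≥ …` the eigenvalues of `A` and
`u₁, u₂, …` orthonormal eigenvectors:
`Q = λ_{r+1}⁻¹ I + ∑_{i ≤ r} (λᵢ⁻¹ - λ_{r+1}⁻¹) uᵢ uᵢᵀ`.
It does not depend on the choice of the eigenvectors, since the eigenvectors for eigenvalues equal
to `λ_{r+1}` enter with coefficient `0`. -/
def scaling {p : ℕ} (A : Param p →L[ℝ] Param p) (r : Fin p) : Param p →L[ℝ] Param p :=
  (eigenvalue A r)⁻¹ • ContinuousLinearMap.id ℝ (Param p) +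
    ∑ i ∈ Finset.Iio r, ((eigenvalue A i)⁻¹ - (eigenvalue A r)⁻¹) •
      InnerProductSpace.rankOne ℝ (eigenvector A i) (eigenvector A i)

open Classical in
/-- Euclidean projection onto `C`: a point of `C` at minimal distance from `θ`. There is exactly one
if `C` is nonempty, closed and convex. (The value is `θ` if there is none.) -/
def proj {p : ℕ} (C : Set (Param p)) (θ : Param p) : Param p :=
  if h : ∃ θ' ∈ C, ∀ z ∈ C, ‖θ - θ'‖ ≤ ‖θ - z‖ then h.choose else θ

open Classical in
/-- One iteration with step size `η` and sub-sample `s`. It needs `λ_{r+1}(H_S(θ)) > 0`, since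
otherwise the scaling matrix is undefined; in that case the iterate is left unchanged. -/
def step {p n m : ℕ} (f : Fin n → Param p → ℝ) (C : Set (Param p)) (r : Fin p) (η : ℝ)
    (s : Fin m → Fin n) (θ : Param p) : Param p :=
  if 0 < eigenvalue (subHessian f s θ) r then
    proj C (θ - η • scaling (subHessian f s θ) r (∇ (average f) θ))
  else θ

/-- The iterates `θ̂⁰, θ̂¹, …` with initial point `θ₀`, step sizes `η t` and sub-samples `s t` of
sizes `m t`. -/
def iterate {p n : ℕ} (f : Fin n → Param p → ℝ) (C : Set (Param p)) (r : Fin p) (η : ℕ → ℝ)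
    {m : ℕ → ℕ} (s : (t : ℕ) → Fin (m t) → Fin n) (θ₀ : Param p) : ℕ → Param p
  | 0 => θ₀
  | t + 1 => step f C r (η t) (s t) (iterate f C r η s θ₀ t)

/-- Independent uniform sub-sampling from `n` indices: the sub-samples are independent, and the
`t`-th one consists of `m t` indices drawn uniformly with replacement (uniform over all sequences)
or without replacement (uniform over the sequences of distinct indices). -/
structure IsUniformSubsampling {Ω : Type*} [MeasurableSpace Ω] (μ : Measure Ω) {n : ℕ} {m : ℕ → ℕ}
    (S : (t : ℕ) → Ω → Fin (m t) → Fin n) : Prop where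
  measurable : ∀ t, Measurable (S t)
  independent : iIndepFun S μ
  uniform : ∀ t, μ.map (S t) = uniformOn Set.univ ∨
    μ.map (S t) = uniformOn {s | Function.Injective s}

/-- The terms of the negative log-likelihood of a generalized linear model with canonical link,
`fᵢ(θ) = Φ(⟨xᵢ, θ⟩) - yᵢ ⟨xᵢ, θ⟩`. -/
def glm {p n : ℕ} (Φ : ℝ → ℝ) (x : Fin n → Param p) (y : Fin n → ℝ) (i : Fin n)
    (θ : Param p) : ℝ :=
  Φ (inner ℝ (x i) θ) - y i * inner ℝ (x i) θ

end NewSamp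

end

open MeasureTheory ProbabilityTheory
open scoped NNReal Gradient

namespace NewSamp

variable {E ι Ω K : Type*} [NormedAddCommGroup E] [InnerProductSpace ℝ E] [Fintype ι]

/-! Deterministic half (`norm_step_sub_le`). Let `A` be the sub-sampled Hessian, `H` the full
Hessian and `g` the gradient of the average, all at the current `θ`, and let `Q` be the scaling
matrix. Before projection, the new error is `(I - QA)(θ - θs) + Q(A - H)(θ - θs) - Q(g - H(θ -
θs))`. In the eigenbasis of `A`, `Q` inverts the `r` leading eigenvalues and replaces the others by
`λ_{r+1}` before inverting, so `‖Q‖ ≤ 1/λ_{r+1}` and `‖I - QA‖ ≤ 1 - λ_p/λ_{r+1}`. Since the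
gradient vanishes at `θs`, the last bracket is a Taylor remainder and gives the quadratic term.
Projecting does not increase the distance to `θs ∈ C`.

Random half (`uniformOn_real_not_norm_average_sub_average_le`). At a fixed point, `‖A - H‖ ≤ 4R
√(log p / m)` outside an event of probability at most `2/p`. The method of exchangeable pairs covers
sampling with and without replacement alike: modify one entry of the sample, and the changes of the
centred sum `X`, added over all moves, give back a multiple of `X`. This yields a differential
inequality for the summed traces of `exp(tX)` (`sum_exp_eigenvalues_le`), hence a Gaussian tail by
Markov's inequality.

The current iterate depends only on earlier samples, which are independent of the present one, so
the bound at fixed points transfers to it (`measureReal_mem_le_of_indepFun`). -/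

theorem inner_eigenbasis_apply (b : OrthonormalBasis ι ℝ E) {A : E →L[ℝ] E} {a : ι → ℝ}
    (hA : ∀ i, A (b i) = a i • b i) (i : ι) (v : E) :
    inner ℝ (b i) (A v) = a i * inner ℝ (b i) v := by
  conv_lhs => rw [← b.sum_repr' v]
  classical
  simp only [map_sum, map_smul, hA, inner_sum, inner_smul_right, b.inner_eq_ite]
  simp [mul_comm]

theorem norm_apply_le_of_eigenbasis (b : OrthonormalBasis ι ℝ E) {A : E →L[ℝ] E} {a : ι → ℝ}
    (hA : ∀ i, A (b i) = a i • b i) {M : ℝ} (hM : 0 ≤ M) (ha : ∀ i, |a i| ≤ M) (v : E) :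
    ‖A v‖ ≤ M * ‖v‖ := by
  refine le_of_sq_le_sq ?_ (by positivity)
  rw [mul_pow, ← b.sum_sq_inner_right (A v), ← b.sum_sq_inner_right v, Finset.mul_sum]
  refine Finset.sum_le_sum fun i _ => ?_
  rw [inner_eigenbasis_apply b hA, mul_pow]
  exact mul_le_mul_of_nonneg_right (sq_le_sq' (neg_le_of_abs_le (ha i)) (le_of_abs_le (ha i)))
    (sq_nonneg _)

/-! ### Matrix concentration by exchangeable pairs -/

/-- The tangent line of the convex function `exp` at the larger point bounds the increment. This is
the scalar core of a mean value inequality for traces; a factor `1/2` is given away, which only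
affects the final constant. -/
theorem sub_mul_exp_sub_exp_le (x y : ℝ) :
    (x - y) * (Real.exp x - Real.exp y) ≤ (x - y) ^ 2 * (Real.exp x + Real.exp y) := by
  have key : ∀ x y : ℝ, y ≤ x → Real.exp x - Real.exp y ≤ (x - y) * Real.exp x := by
    intro x y _
    have h1 := Real.add_one_le_exp (y - x)
    have h2 : Real.exp y = Real.exp (y - x) * Real.exp x := by rw [← Real.exp_add]; ring_nf
    nlinarith [Real.exp_pos x]
  rcases le_total y x with h | h
  · nlinarith [mul_le_mul_of_nonneg_left (key x y h) (sub_nonneg.2 h), Real.exp_pos y,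
      mul_nonneg (sq_nonneg (x - y)) (Real.exp_pos y).le]
  · nlinarith [mul_le_mul_of_nonneg_left (key y x h) (sub_nonneg.2 h), Real.exp_pos x,
      mul_nonneg (sq_nonneg (x - y)) (Real.exp_pos x).le]

/-- If `F' ≤ v t F` on `[0, ∞)` then `F(t) ≤ F(0) exp (v t² / 2)`. -/
theorem le_mul_exp_of_deriv_le {F F' : ℝ → ℝ} {v : ℝ} (hF : ∀ t, HasDerivAt F (F' t) t)
    (h : ∀ t, 0 ≤ t → F' t ≤ v * t * F t) {t : ℝ} (ht : 0 ≤ t) :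
    F t ≤ F 0 * Real.exp (v * t ^ 2 / 2) := by
  -- Integrating factor: `F(t) exp(-v t² / 2)` is nonincreasing on `[0, ∞)`.
  have hG : ∀ t, HasDerivAt (fun t => F t * Real.exp (-(v * t ^ 2 / 2)))
      ((F' t - v * t * F t) * Real.exp (-(v * t ^ 2 / 2))) t := by
    intro t
    have h1 : HasDerivAt (fun t : ℝ => -(v * t ^ 2 / 2)) (-(v * t)) t := by
      refine HasDerivAt.congr_deriv (f' := -(v * (2 * t) / 2)) ?_ (by ring)
      simpa using (((hasDerivAt_pow 2 t).const_mul v).div_const 2).fun_neg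
    exact ((hF t).mul h1.exp).congr_deriv (by ring)
  have hanti : AntitoneOn (fun t => F t * Real.exp (-(v * t ^ 2 / 2))) (Set.Ici 0) := by
    refine antitoneOn_of_deriv_nonpos (convex_Ici 0)
      (fun t _ => (hG t).continuousAt.continuousWithinAt)
      (fun t _ => (hG t).differentiableAt.differentiableWithinAt) fun t ht => ?_
    rw [interior_Ici] at ht
    rw [(hG t).deriv]
    exact mul_nonpos_of_nonpos_of_nonneg (by linarith [h t (le_of_lt ht)]) (Real.exp_pos _).le
  have := hanti (Set.mem_Ici.2 le_rfl) (Set.mem_Ici.2 ht) ht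
  simp only [ne_eq, OfNat.ofNat_ne_zero, not_false_eq_true, zero_pow, mul_zero, zero_div, neg_zero,
    Real.exp_zero, mul_one, Real.exp_neg] at this
  rwa [← div_eq_mul_inv, div_le_iff₀ (Real.exp_pos _)] at this

/-- Matrix concentration by exchangeable pairs. The pairs are `(ω, (T (ω, k)).1)` for an involution
`T`; the random matrix `X ω` has eigenbasis `b ω` and eigenvalues `a ω`. -/
theorem sum_exp_eigenvalues_le [Fintype Ω] [Fintype K] {T : Ω × K → Ω × K}
    (hT : Function.Involutive T) {X : Ω → E →L[ℝ] E} {b : Ω → OrthonormalBasis ι ℝ E}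
    {a : Ω → ι → ℝ} (hb : ∀ ω i, X ω (b ω i) = a ω i • b ω i) {N d : ℝ} (hN : 0 < N)
    (hmean : ∀ ω, ∑ k, (X ω - X (T (ω, k)).1) = N • X ω)
    (hdiff : ∀ ω k v, ‖(X ω - X (T (ω, k)).1) v‖ ≤ d * ‖v‖) {t : ℝ} (ht : 0 ≤ t) :
    ∑ ω, ∑ i, Real.exp (t * a ω i) ≤
      Fintype.card Ω * Fintype.card ι * Real.exp (Fintype.card K * d ^ 2 / N * t ^ 2 / 2) := by
  classical
  -- `X ω` and `X ω'` need not commute. Squared overlaps of their eigenbases turn the traces below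
  -- into double sums over pairs of eigenvalues, where scalar inequalities apply termwise.
  set w : Ω → Ω → ι → ι → ℝ := fun ω ω' i j => (inner ℝ (b ω i) (b ω' j)) ^ 2 with hw
  have hw0 : ∀ ω ω' i j, 0 ≤ w ω ω' i j := fun _ _ _ _ => sq_nonneg _
  have hwsymm : ∀ ω ω' i j, w ω ω' i j = w ω' ω j i := by
    intro ω ω' i j
    simp only [hw, real_inner_comm]
  have hXinner : ∀ ω j v, inner ℝ (b ω j) (X ω v) = a ω j * inner ℝ (b ω j) v :=
    fun ω => inner_eigenbasis_apply (b ω) (hb ω)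
  have hfirst : ∀ ω ω' i, inner ℝ (b ω i) ((X ω - X ω') (b ω i)) =
      ∑ j, w ω ω' i j * (a ω i - a ω' j) := by
    intro ω ω' i
    rw [← (b ω').sum_inner_mul_inner]
    refine Finset.sum_congr rfl fun j _ => ?_
    rw [sub_apply, inner_sub_right, hXinner, hb, inner_smul_right,
      real_inner_comm (b ω i) (b ω' j)]
    simp only [hw]
    ring
  have hsecond : ∀ ω ω' i, ‖(X ω - X ω') (b ω i)‖ ^ 2 =
      ∑ j, w ω ω' i j * (a ω i - a ω' j) ^ 2 := by
    intro ω ω' i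
    rw [← (b ω').sum_sq_inner_right]
    refine Finset.sum_congr rfl fun j _ => ?_
    rw [sub_apply, inner_sub_right, hXinner, hb, inner_smul_right,
      real_inner_comm (b ω i) (b ω' j)]
    simp only [hw]
    ring
  -- Exchangeability: reindexing by the involution `T` swaps the two members of each pair.
  have hsum : ∀ f : Ω → Ω → ℝ, ∑ z : Ω × K, f z.1 (T z).1 = ∑ z : Ω × K, f (T z).1 z.1 := by
    intro f
    rw [← Equiv.sum_comp hT.toPerm]
    exact Finset.sum_congr rfl fun z _ => by simp [hT z]
  have hderiv : ∀ t, HasDerivAt (fun t => ∑ ω, ∑ i, Real.exp (t * a ω i))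
      (∑ ω, ∑ i, a ω i * Real.exp (t * a ω i)) t := by
    intro t
    refine HasDerivAt.fun_sum fun ω _ => HasDerivAt.fun_sum fun i _ => ?_
    simpa [mul_comm] using ((hasDerivAt_id t).mul_const (a ω i)).exp
  have hbound : ∀ t, 0 ≤ t → ∑ ω, ∑ i, a ω i * Real.exp (t * a ω i) ≤
      Fintype.card K * d ^ 2 / N * t * ∑ ω, ∑ i, Real.exp (t * a ω i) := by
    intro t ht
    have e1 : N * ∑ ω, ∑ i, a ω i * Real.exp (t * a ω i) =
        ∑ z : Ω × K, ∑ i, ∑ j, w z.1 (T z).1 i j * (a z.1 i - a (T z).1 j) *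
          Real.exp (t * a z.1 i) := by
      rw [Fintype.sum_prod_type, Finset.mul_sum]
      refine Finset.sum_congr rfl fun ω _ => ?_
      rw [Finset.sum_comm, Finset.mul_sum]
      refine Finset.sum_congr rfl fun i _ => ?_
      simp_rw [← Finset.sum_mul, ← hfirst]
      rw [← inner_sum, ← sum_apply, hmean]
      simp [hb, inner_smul_right]
      ring
    have e2 : N * ∑ ω, ∑ i, a ω i * Real.exp (t * a ω i) =
        -∑ z : Ω × K, ∑ i, ∑ j, w z.1 (T z).1 i j * (a z.1 i - a (T z).1 j) *
          Real.exp (t * a (T z).1 j) := by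
      rw [e1, hsum fun ω ω' => ∑ i, ∑ j, w ω ω' i j * (a ω i - a ω' j) * Real.exp (t * a ω i),
        ← Finset.sum_neg_distrib]
      refine Finset.sum_congr rfl fun z _ => ?_
      rw [Finset.sum_comm, ← Finset.sum_neg_distrib]
      refine Finset.sum_congr rfl fun i _ => ?_
      rw [← Finset.sum_neg_distrib]
      refine Finset.sum_congr rfl fun j _ => ?_
      rw [hwsymm]
      ring
    have e3 : ∑ z : Ω × K, ∑ i, ∑ j, w z.1 (T z).1 i j * (a z.1 i - a (T z).1 j) ^ 2 *
          Real.exp (t * a (T z).1 j) =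
        ∑ z : Ω × K, ∑ i, ∑ j, w z.1 (T z).1 i j * (a z.1 i - a (T z).1 j) ^ 2 *
          Real.exp (t * a z.1 i) := by
      rw [hsum fun ω ω' => ∑ i, ∑ j, w ω ω' i j * (a ω i - a ω' j) ^ 2 * Real.exp (t * a ω' j)]
      refine Finset.sum_congr rfl fun z _ => ?_
      rw [Finset.sum_comm]
      refine Finset.sum_congr rfl fun i _ => Finset.sum_congr rfl fun j _ => ?_
      rw [hwsymm]
      ring
    have e4 : ∑ z : Ω × K, ∑ i, ∑ j, w z.1 (T z).1 i j * (a z.1 i - a (T z).1 j) ^ 2 *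
          Real.exp (t * a z.1 i) ≤
        Fintype.card K * d ^ 2 * ∑ ω, ∑ i, Real.exp (t * a ω i) := by
      have : Fintype.card K * d ^ 2 * ∑ ω, ∑ i, Real.exp (t * a ω i) =
          ∑ z : Ω × K, ∑ i, d ^ 2 * Real.exp (t * a z.1 i) := by
        rw [Fintype.sum_prod_type_right]
        simp only [← Finset.mul_sum, Finset.sum_const, Finset.card_univ, nsmul_eq_mul]
        ring
      rw [this]
      refine Finset.sum_le_sum fun z _ => Finset.sum_le_sum fun i _ => ?_
      rw [← Finset.sum_mul, ← hsecond]
      gcongr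
      simpa using hdiff z.1 z.2 (b z.1 i)
    -- Averaging `e1` with its swapped form `e2` produces the product `(x - y)(exp x - exp y)`; `e3`
    -- symmetrizes the upper bound in the same way.
    have e5 : 2 * (N * ∑ ω, ∑ i, a ω i * Real.exp (t * a ω i)) ≤
        t * (2 * ∑ z : Ω × K, ∑ i, ∑ j, w z.1 (T z).1 i j * (a z.1 i - a (T z).1 j) ^ 2 *
          Real.exp (t * a z.1 i)) := by
      rw [two_mul, two_mul]
      nth_rewrite 1 [e1]
      rw [e2]
      nth_rewrite 1 [← e3]
      simp only [← sub_eq_add_neg, ← Finset.sum_sub_distrib, ← Finset.sum_add_distrib,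
        Finset.mul_sum]
      refine Finset.sum_le_sum fun z _ => Finset.sum_le_sum fun i _ =>
        Finset.sum_le_sum fun j _ => ?_
      rcases ht.eq_or_lt with rfl | ht'
      · simp
      · have := sub_mul_exp_sub_exp_le (t * a z.1 i) (t * a (T z).1 j)
        have h2 : (a z.1 i - a (T z).1 j) *
            (Real.exp (t * a z.1 i) - Real.exp (t * a (T z).1 j)) ≤
            t * ((a z.1 i - a (T z).1 j) ^ 2 *
            (Real.exp (t * a z.1 i) + Real.exp (t * a (T z).1 j))) := by
          refine le_of_mul_le_mul_left ?_ ht'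
          linarith
        linarith [mul_le_mul_of_nonneg_left h2 (hw0 z.1 (T z).1 i j)]
    have e6 := e5.trans (mul_le_mul_of_nonneg_left (mul_le_mul_of_nonneg_left e4 zero_le_two) ht)
    rw [div_mul_eq_mul_div, div_mul_eq_mul_div, le_div_iff₀ hN]
    linarith
  have := le_mul_exp_of_deriv_le hderiv hbound ht
  simpa using this

/-- Two-sided tail bound for the largest absolute eigenvalue. -/
theorem card_exists_lt_abs_eigenvalue_le [Fintype Ω] [Fintype K] {T : Ω × K → Ω × K}
    (hT : Function.Involutive T) {X : Ω → E →L[ℝ] E} {b : Ω → OrthonormalBasis ι ℝ E}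
    {a : Ω → ι → ℝ} (hb : ∀ ω i, X ω (b ω i) = a ω i • b ω i) {N d : ℝ} (hN : 0 < N)
    (hmean : ∀ ω, ∑ k, (X ω - X (T (ω, k)).1) = N • X ω)
    (hdiff : ∀ ω k v, ‖(X ω - X (T (ω, k)).1) v‖ ≤ d * ‖v‖)
    (hv : 0 < Fintype.card K * d ^ 2 / N) {z : ℝ} (hz : 0 ≤ z) (B : Finset Ω)
    (hB : ∀ ω ∈ B, ∃ i, z < |a ω i|) :
    (B.card : ℝ) ≤ Fintype.card Ω *
      (2 * Fintype.card ι * Real.exp (-z ^ 2 / (2 * (Fintype.card K * d ^ 2 / N)))) := by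
  set V : ℝ := Fintype.card K * d ^ 2 / N with hV
  -- `t = z / V` minimizes the Chernoff exponent `V t² / 2 - t z`.
  have ht : 0 ≤ z / V := by positivity
  have h1 := sum_exp_eigenvalues_le hT hb hN hmean hdiff ht
  -- The hypotheses are invariant under `X ↦ -X`, which gives the lower tail.
  have h2 := sum_exp_eigenvalues_le (X := fun ω => -X ω) (b := b) (a := fun ω i => -a ω i) hT
    (by intro ω i; simp [hb]) hN
    (by
      intro ω
      rw [smul_neg, ← hmean, ← Finset.sum_neg_distrib]
      exact Finset.sum_congr rfl fun k _ => by abel)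
    (by
      intro ω k v
      rw [show -X ω - -X (T (ω, k)).1 = -(X ω - X (T (ω, k)).1) by abel,
        neg_apply, norm_neg]
      exact hdiff ω k v) ht
  rw [← hV] at h1 h2
  have h3 : (B.card : ℝ) * Real.exp (z / V * z) ≤
      ∑ ω, ∑ i, (Real.exp (z / V * a ω i) + Real.exp (z / V * -a ω i)) := by
    rw [← nsmul_eq_mul, ← Finset.sum_const]
    refine (Finset.sum_le_sum fun ω hω => ?_).trans
      (Finset.sum_le_sum_of_subset_of_nonneg B.subset_univ fun ω _ _ => by positivity)
    obtain ⟨i, hi⟩ := hB ω hω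
    refine le_trans ?_ (Finset.single_le_sum (fun i _ => by positivity) (Finset.mem_univ i))
    rcases lt_abs.1 hi with h | h
    · have : Real.exp (z / V * z) ≤ Real.exp (z / V * a ω i) := by gcongr
      linarith [Real.exp_pos (z / V * -a ω i)]
    · have : Real.exp (z / V * z) ≤ Real.exp (z / V * -a ω i) := by gcongr
      linarith [Real.exp_pos (z / V * a ω i)]
  simp only [Finset.sum_add_distrib] at h3
  have h4 : (B.card : ℝ) ≤ (2 * (Fintype.card Ω * Fintype.card ι *
      Real.exp (V * (z / V) ^ 2 / 2))) / Real.exp (z / V * z) := by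
    rw [le_div_iff₀ (Real.exp_pos _)]
    linarith
  refine h4.trans_eq ?_
  have h5 : Real.exp (V * (z / V) ^ 2 / 2) / Real.exp (z / V * z) =
      Real.exp (-z ^ 2 / (2 * V)) := by
    rw [← Real.exp_sub]
    congr 1
    field_simp
    ring
  rw [← h5]
  ring

/-- Matrix concentration for exchangeable pairs whose moves are indexed by `Fin m × Fin n`. -/
theorem card_lt_norm_apply_le {p m n : ℕ} (hm : 0 < m) (hn : 0 < n) {Ω : Type*} [Fintype Ω]
    {T : Ω × (Fin m × Fin n) → Ω × (Fin m × Fin n)} (hT : Function.Involutive T)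
    {X : Ω → Param p →L[ℝ] Param p}
    (hX : ∀ ω, ((X ω : Param p →L[ℝ] Param p) : Param p →ₗ[ℝ] Param p).IsSymmetric)
    (hmean : ∀ ω, ∑ k, (X ω - X (T (ω, k)).1) = (n : ℝ) • X ω) {d : ℝ} (hd : 0 < d)
    (hdiff : ∀ ω k v, ‖(X ω - X (T (ω, k)).1) v‖ ≤ d * ‖v‖) {z : ℝ} (hz : 0 ≤ z)
    (B : Finset Ω) (hB : ∀ ω ∈ B, ∃ v, z * ‖v‖ < ‖X ω v‖) :
    (B.card : ℝ) ≤ Fintype.card Ω * (2 * p * Real.exp (-z ^ 2 / (2 * (m * d ^ 2)))) := by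
  have hn' : (0 : ℝ) < n := by exact_mod_cast hn
  have hm' : (0 : ℝ) < m := by exact_mod_cast hm
  have hV : (Fintype.card (Fin m × Fin n) : ℝ) * d ^ 2 / n = m * d ^ 2 := by
    simp only [Fintype.card_prod, Fintype.card_fin, Nat.cast_mul]
    field_simp
  have hb : ∀ ω i, X ω ((hX ω).eigenvectorBasis finrank_euclideanSpace_fin i) =
      (hX ω).eigenvalues finrank_euclideanSpace_fin i •
        (hX ω).eigenvectorBasis finrank_euclideanSpace_fin i :=
    fun ω i => (hX ω).apply_eigenvectorBasis finrank_euclideanSpace_fin i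
  have := card_exists_lt_abs_eigenvalue_le hT hb hn' hmean hdiff (by rw [hV]; positivity) hz B
    (fun ω hω => by
      by_contra! hcon
      obtain ⟨v, hv⟩ := hB ω hω
      exact absurd hv (not_lt.2 (norm_apply_le_of_eigenbasis _ (hb ω) hz hcon v)))
  rwa [hV, Fintype.card_fin] at this

/-! ### Moves on samples, with and without replacement -/

section Moves

variable {m n : ℕ} {M : Type*} [AddCommGroup M]

theorem sum_sum_sub_eq_nsmul (Z : Fin n → M) (hZ : ∑ i, Z i = 0) (s : Fin m → Fin n) :
    ∑ j, ∑ i, (Z (s j) - Z i) = n • ∑ j, Z (s j) := by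
  simp [Finset.sum_sub_distrib, hZ, Finset.smul_sum]

theorem sum_sub_sum_update (Z : Fin n → M) (s : Fin m → Fin n) (j : Fin m) (i : Fin n) :
    ∑ l, Z (s l) - ∑ l, Z (Function.update s j i l) = Z (s j) - Z i := by
  rw [← Finset.sum_sub_distrib, Finset.sum_eq_single j]
  · simp
  · intro l _ hl
    simp [hl]
  · simp

/-- Replacing one entry of a sequence, as an involution that remembers the old entry. -/
def updateMove (m n : ℕ) (w : (Fin m → Fin n) × (Fin m × Fin n)) :
    (Fin m → Fin n) × (Fin m × Fin n) :=
  (Function.update w.1 w.2.1 w.2.2, (w.2.1, w.1 w.2.1))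

theorem updateMove_involutive : Function.Involutive (updateMove m n) := by
  rintro ⟨s, j, i⟩
  simp [updateMove]

/-- Replacing one entry `s j` of an injective sequence by `i`, or exchanging `s j` and `i` if `i`
is in the range, as an involution that remembers the old entry. -/
def swapMove (m n : ℕ)
    (w : {s : Fin m → Fin n // Function.Injective s} × (Fin m × Fin n)) :
    {s : Fin m → Fin n // Function.Injective s} × (Fin m × Fin n) :=
  (⟨Equiv.swap (w.1.1 w.2.1) w.2.2 ∘ w.1.1, (Equiv.injective _).comp w.1.2⟩,
    (w.2.1, w.1.1 w.2.1))

theorem swapMove_involutive : Function.Involutive (swapMove m n) := by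
  rintro ⟨⟨s, hs⟩, j, i⟩
  simp only [swapMove, Function.comp_apply, Equiv.swap_apply_left, Prod.mk.injEq, Subtype.mk.injEq,
    and_true]
  ext l
  simp [Equiv.swap_comm i (s j)]

theorem sum_swap_of_notMem_range (Z : Fin n → M) {s : Fin m → Fin n}
    (hs : Function.Injective s) (j : Fin m) {i : Fin n} (hi : i ∉ Set.range s) :
    ∑ l, Z (s l) - ∑ l, Z (Equiv.swap (s j) i (s l)) = Z (s j) - Z i := by
  rw [← sum_sub_sum_update Z s j i]
  congr 1
  refine Finset.sum_congr rfl fun l _ => ?_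
  by_cases hl : l = j
  · subst hl; simp
  · rw [Function.update_of_ne hl,
      Equiv.swap_apply_of_ne_of_ne (hs.ne hl) fun h => hi ⟨l, h⟩]

theorem sum_swap_of_mem_range (Z : Fin n → M) {s : Fin m → Fin n}
    (hs : Function.Injective s) (j l : Fin m) :
    ∑ k, Z (Equiv.swap (s j) (s l) (s k)) = ∑ k, Z (s k) := by
  rw [← Equiv.sum_comp (Equiv.swap j l) fun k => Z (s k)]
  exact Finset.sum_congr rfl fun k _ => by rw [hs.map_swap]

/-- An index `i` outside the range acts as a replacement; one inside only permutes the sample and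
contributes zero. Replacements by indices inside the range would contribute `∑ⱼ ∑ₗ (Z (s j) - Z (s
l))`, which vanishes by antisymmetry, so the multiple is `n`, as with replacement. -/
theorem sum_sum_sub_sum_swap (Z : Fin n → M) (hZ : ∑ i, Z i = 0) {s : Fin m → Fin n}
    (hs : Function.Injective s) :
    ∑ j, ∑ i, (∑ l, Z (s l) - ∑ l, Z (Equiv.swap (s j) i (s l))) = n • ∑ j, Z (s j) := by
  classical
  have h : ∀ j, ∑ i, (∑ l, Z (s l) - ∑ l, Z (Equiv.swap (s j) i (s l))) =
      ∑ i, (Z (s j) - Z i) - ∑ l, (Z (s j) - Z (s l)) := by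
    intro j
    have h1 : ∑ l, (Z (s j) - Z (s l)) =
        ∑ i, if i ∈ Set.range s then Z (s j) - Z i else 0 := by
      rw [← Finset.sum_filter, ← Finset.sum_image (s := Finset.univ) (g := s)
        (f := fun i => Z (s j) - Z i) fun _ _ _ _ h => hs h]
      refine Finset.sum_congr ?_ fun _ _ => rfl
      ext i
      simp
    rw [h1, ← Finset.sum_sub_distrib]
    refine Finset.sum_congr rfl fun i _ => ?_
    split_ifs with hi
    · obtain ⟨l, rfl⟩ := hi
      rw [sum_swap_of_mem_range Z hs]
      simp
    · rw [sum_swap_of_notMem_range Z hs j hi, sub_zero]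
  simp_rw [h]
  rw [Finset.sum_sub_distrib, sum_sum_sub_eq_nsmul Z hZ, sub_eq_self]
  simp only [Finset.sum_sub_distrib]
  rw [Finset.sum_comm, sub_self]

end Moves

/-! ### Tail bounds for sampled averages of operators -/

section Sampling

variable {p m n : ℕ} {Z : Fin n → Param p →L[ℝ] Param p} {d z : ℝ}

theorem isSymmetric_sum {κ : Type*} (s : Finset κ) {A : κ → Param p →L[ℝ] Param p}
    (hA : ∀ i ∈ s, ((A i : Param p →L[ℝ] Param p) : Param p →ₗ[ℝ] Param p).IsSymmetric) :
    ((∑ i ∈ s, A i : Param p →L[ℝ] Param p) : Param p →ₗ[ℝ] Param p).IsSymmetric := by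
  intro v w
  simp only [ContinuousLinearMap.coe_coe, sum_apply, sum_inner, inner_sum]
  exact Finset.sum_congr rfl fun i hi => hA i hi v w

theorem card_filter_lt_norm_sum_apply_le (hm : 0 < m) (hn : 0 < n)
    (hZs : ∀ i, ((Z i : Param p →L[ℝ] Param p) : Param p →ₗ[ℝ] Param p).IsSymmetric)
    (hZ : ∑ i, Z i = 0) (hd : 0 < d) (hZd : ∀ i k v, ‖(Z i - Z k) v‖ ≤ d * ‖v‖) (hz : 0 ≤ z)
    (B : Finset (Fin m → Fin n)) (hB : ∀ s ∈ B, ∃ v, z * ‖v‖ < ‖(∑ j, Z (s j)) v‖) :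
    (B.card : ℝ) ≤
      Fintype.card (Fin m → Fin n) * (2 * p * Real.exp (-z ^ 2 / (2 * (m * d ^ 2)))) := by
  refine card_lt_norm_apply_le hm hn updateMove_involutive (X := fun s => ∑ j, Z (s j))
    (fun s => isSymmetric_sum _ fun j _ => hZs _) (fun s => ?_) hd (fun s k v => ?_) hz B hB
  · simp only [updateMove, sum_sub_sum_update]
    rw [Fintype.sum_prod_type, sum_sum_sub_eq_nsmul Z hZ, ← Nat.cast_smul_eq_nsmul ℝ]
  · simp only [updateMove, sum_sub_sum_update]
    exact hZd _ _ v

theorem card_filter_lt_norm_sum_apply_le_of_injective (hm : 0 < m) (hn : 0 < n)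
    (hZs : ∀ i, ((Z i : Param p →L[ℝ] Param p) : Param p →ₗ[ℝ] Param p).IsSymmetric)
    (hZ : ∑ i, Z i = 0) (hd : 0 < d) (hZd : ∀ i k v, ‖(Z i - Z k) v‖ ≤ d * ‖v‖) (hz : 0 ≤ z)
    (B : Finset {s : Fin m → Fin n // Function.Injective s})
    (hB : ∀ s ∈ B, ∃ v, z * ‖v‖ < ‖(∑ j, Z (s.1 j)) v‖) :
    (B.card : ℝ) ≤ Fintype.card {s : Fin m → Fin n // Function.Injective s} *
      (2 * p * Real.exp (-z ^ 2 / (2 * (m * d ^ 2)))) := by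
  refine card_lt_norm_apply_le hm hn swapMove_involutive (X := fun s => ∑ j, Z (s.1 j))
    (fun s => isSymmetric_sum _ fun j _ => hZs _) (fun s => ?_) hd (fun s k v => ?_) hz B hB
  · simp only [swapMove, Function.comp_apply]
    rw [Fintype.sum_prod_type, sum_sum_sub_sum_swap Z hZ s.2, ← Nat.cast_smul_eq_nsmul ℝ]
  · simp only [swapMove, Function.comp_apply]
    by_cases hk : k.2 ∈ Set.range s.1
    · obtain ⟨l, hl⟩ := hk
      rw [← hl, sum_swap_of_mem_range Z s.2]
      simpa using by positivity
    · rw [sum_swap_of_notMem_range Z s.2 _ hk]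
      exact hZd _ _ v

/-- Passes from counting to probability. If `A` is empty, `uniformOn A` is the zero measure and the
bound is trivial. -/
theorem uniformOn_real_le {α : Type*} [Fintype α] [MeasurableSpace α]
    [MeasurableSingletonClass α] (A B : Set α) {q : ℝ} (hq : 0 ≤ q)
    (h : ∀ B' : Finset A, (∀ a ∈ B', (a : α) ∈ B) → (B'.card : ℝ) ≤ Nat.card A * q) :
    (uniformOn A).real B ≤ q := by
  classical
  have hA := A.toFinite
  have h1 := h (Finset.univ.filter fun a : A => (a : α) ∈ B) (by simp)
  have h2 : ((Finset.univ.filter fun a : A => (a : α) ∈ B).card : ℝ) = Set.ncard (A ∩ B) := by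
    rw [Set.ncard_eq_toFinset_card', ← Finset.card_map (Function.Embedding.subtype _)]
    congr 2
    ext a
    simp [and_comm]
  rw [h2] at h1
  rw [uniformOn, measureReal_def, cond_apply hA.measurableSet, ENNReal.toReal_mul,
    ENNReal.toReal_inv, Measure.count_apply hA.measurableSet,
    Measure.count_apply (A ∩ B).toFinite.measurableSet, ← hA.cast_ncard_eq,
    ← (A ∩ B).toFinite.cast_ncard_eq]
  simp only [ENat.toENNReal_coe, ENNReal.toReal_natCast]
  rw [← Nat.card_coe_set_eq A]
  rcases (Nat.cast_nonneg (α := ℝ) (Nat.card A)).eq_or_lt with h0 | h0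
  · rw [← h0]
    simpa using hq
  · rwa [inv_mul_le_iff₀ h0]

/-- The average of a uniform sample of symmetric operators is close to the average of all. -/
theorem uniformOn_real_not_norm_average_sub_average_le (hp : 0 < p) (hm : 0 < m) (hn : 0 < n)
    {ν : Measure (Fin m → Fin n)}
    (hν : ν = uniformOn Set.univ ∨ ν = uniformOn {s | Function.Injective s})
    {Y : Fin n → Param p →L[ℝ] Param p}
    (hYs : ∀ i, ((Y i : Param p →L[ℝ] Param p) : Param p →ₗ[ℝ] Param p).IsSymmetric)
    {R : ℝ} (hR : 0 < R) (hY : ∀ i v, ‖Y i v‖ ≤ R * ‖v‖) :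
    ν.real {s | ¬∀ v, ‖((1 / (m : ℝ)) • ∑ j, Y (s j) - (1 / (n : ℝ)) • ∑ i, Y i) v‖ ≤
      4 * R * Real.sqrt (Real.log p / m) * ‖v‖} ≤ 2 / p := by
  classical
  have hp' : (0 : ℝ) < p := by exact_mod_cast hp
  have hm' : (0 : ℝ) < m := by exact_mod_cast hm
  have hn' : (0 : ℝ) < n := by exact_mod_cast hn
  have hlog : 0 ≤ Real.log p := Real.log_natCast_nonneg p
  set A := (1 / (n : ℝ)) • ∑ i, Y i with hA
  have hAs : ((A : Param p →L[ℝ] Param p) : Param p →ₗ[ℝ] Param p).IsSymmetric := by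
    intro v w
    have := isSymmetric_sum Finset.univ (fun i _ => hYs i) v w
    rw [ContinuousLinearMap.coe_coe] at this ⊢
    rw [hA, smul_apply, smul_apply, inner_smul_left, inner_smul_right, this]
    simp
  set Z : Fin n → Param p →L[ℝ] Param p := fun i => Y i - A with hZ
  have hZs : ∀ i, ((Z i : Param p →L[ℝ] Param p) : Param p →ₗ[ℝ] Param p).IsSymmetric :=
    fun i => (hYs i).sub hAs
  have hZ0 : ∑ i, Z i = 0 := by
    simp only [hZ, Finset.sum_sub_distrib, Finset.sum_const, Finset.card_univ, Fintype.card_fin]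
    rw [hA, ← Nat.cast_smul_eq_nsmul ℝ, smul_smul, mul_one_div_cancel hn'.ne', one_smul, sub_self]
  -- Centring cancels in differences, so a move changes the sum by at most `2R` in norm.
  have hZd : ∀ i k v, ‖(Z i - Z k) v‖ ≤ 2 * R * ‖v‖ := by
    intro i k v
    have : (Z i - Z k) v = Y i v - Y k v := by simp [hZ]
    rw [this]
    linarith [norm_sub_le (Y i v) (Y k v), hY i v, hY k v]
  set z : ℝ := m * (4 * R * Real.sqrt (Real.log p / m)) with hz
  have hz0 : 0 ≤ z := by positivity
  -- The factor `4` in `z` is chosen so that, with `d = 2R`, the exponent is `-2 log p`, which beats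
  -- the prefactor `2p`.
  have hq : 2 * p * Real.exp (-z ^ 2 / (2 * (m * (2 * R) ^ 2))) = 2 / p := by
    have h1 : -z ^ 2 / (2 * (m * (2 * R) ^ 2)) = -Real.log p - Real.log p := by
      rw [hz, mul_pow, mul_pow _ (Real.sqrt _), Real.sq_sqrt (by positivity)]
      field_simp
      ring
    rw [h1, Real.exp_sub, Real.exp_neg, Real.exp_log hp']
    field_simp
  have hbad : ∀ s : Fin m → Fin n, s ∈ {s | ¬∀ v,
      ‖((1 / (m : ℝ)) • ∑ j, Y (s j) - A) v‖ ≤ 4 * R * Real.sqrt (Real.log p / m) * ‖v‖} →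
      ∃ v, z * ‖v‖ < ‖(∑ j, Z (s j)) v‖ := by
    intro s hs
    obtain ⟨v, hv⟩ := not_forall.1 hs
    refine ⟨v, ?_⟩
    have h1 : ∑ j, Z (s j) = (m : ℝ) • ((1 / (m : ℝ)) • ∑ j, Y (s j) - A) := by
      simp only [hZ, Finset.sum_sub_distrib, Finset.sum_const, Finset.card_univ, Fintype.card_fin]
      rw [smul_sub, smul_smul, mul_one_div_cancel hm'.ne', one_smul, Nat.cast_smul_eq_nsmul]
    rw [h1, smul_apply, norm_smul, Real.norm_natCast, hz, mul_assoc]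
    exact mul_lt_mul_of_pos_left (not_le.1 hv) hm'
  rcases hν with rfl | rfl
  · refine uniformOn_real_le _ _ (by positivity) fun B hB => ?_
    have := card_filter_lt_norm_sum_apply_le hm hn hZs hZ0 (by positivity : 0 < 2 * R) hZd hz0
      (B.map (Function.Embedding.subtype _)) (by
        intro s hs
        obtain ⟨a, ha, rfl⟩ := Finset.mem_map.1 hs
        exact hbad _ (hB a ha))
    rw [hq, Finset.card_map] at this
    simpa using this
  · refine uniformOn_real_le _ _ (by positivity) fun B hB => ?_
    have := card_filter_lt_norm_sum_apply_le_of_injective hm hn hZs hZ0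
      (by positivity : 0 < 2 * R) hZd hz0 B fun s hs => hbad _ (hB s hs)
    rw [hq] at this
    rwa [Nat.card_eq_fintype_card]

end Sampling

/-! ### Euclidean projection -/

section Projection

variable {p : ℕ} {C : Set (Param p)}

/-- Projecting onto a closed convex set does not increase the distance to its points. -/
theorem norm_proj_sub_le (hconv : Convex ℝ C) (hC : IsClosed C) {w : Param p} (hw : w ∈ C)
    (u : Param p) : ‖proj C u - w‖ ≤ ‖u - w‖ := by
  obtain ⟨v₀, hv₀, hmin⟩ := exists_norm_eq_iInf_of_complete_convex ⟨w, hw⟩ hC.isComplete hconv u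
  have hbdd : BddBelow (Set.range fun w : C => ‖u - w‖) :=
    ⟨0, by rintro _ ⟨w, rfl⟩; exact norm_nonneg _⟩
  have hex : ∃ θ' ∈ C, ∀ z ∈ C, ‖u - θ'‖ ≤ ‖u - z‖ :=
    ⟨v₀, hv₀, fun z hz => hmin.trans_le (ciInf_le hbdd ⟨z, hz⟩)⟩
  rw [proj, dif_pos hex]
  obtain ⟨hv, hle⟩ := hex.choose_spec
  set v := hex.choose
  have : Nonempty C := ⟨⟨w, hw⟩⟩
  have hinf : ‖u - v‖ = ⨅ w : C, ‖u - w‖ :=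
    le_antisymm (le_ciInf fun z => hle z z.2) (ciInf_le hbdd ⟨v, hv⟩)
  -- Variational inequality: the angle at the projected point `v` is not acute, so `‖u - w‖² ≥ ‖u -
  -- v‖² + ‖v - w‖²`.
  have hin := (norm_eq_iInf_iff_real_inner_le_zero hconv hv).1 hinf w hw
  refine le_of_sq_le_sq ?_ (norm_nonneg _)
  have h1 : ‖u - w‖ ^ 2 = ‖u - v‖ ^ 2 + 2 * inner ℝ (u - v) (v - w) + ‖v - w‖ ^ 2 := by
    rw [← norm_add_sq_real, sub_add_sub_cancel]
  have h2 : inner ℝ (u - v) (v - w) = -inner ℝ (u - v) (w - v) := by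
    rw [← inner_neg_right, neg_sub]
  nlinarith [sq_nonneg ‖u - v‖]

end Projection

/-! ### The scaling matrix in the eigenbasis -/

section Scaling

variable {p : ℕ} {A : Param p →L[ℝ] Param p}

theorem eigenvalue_antitone (hA : (A : Param p →ₗ[ℝ] Param p).IsSymmetric) :
    Antitone (eigenvalue A) := by
  intro i j hij
  simp only [eigenvalue, dif_pos hA]
  exact hA.eigenvalues_antitone _ hij

theorem exists_eigenbasis (hA : (A : Param p →ₗ[ℝ] Param p).IsSymmetric) :
    ∃ b : OrthonormalBasis (Fin p) ℝ (Param p), (∀ i, eigenvector A i = b i) ∧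
      ∀ i, A (b i) = eigenvalue A i • b i := by
  refine ⟨hA.eigenvectorBasis finrank_euclideanSpace_fin, fun i => ?_, fun i => ?_⟩
  · simp only [eigenvector, dif_pos hA]
  · simp only [eigenvalue, dif_pos hA]
    exact hA.apply_eigenvectorBasis finrank_euclideanSpace_fin i

theorem scaling_apply_eigenbasis {b : OrthonormalBasis (Fin p) ℝ (Param p)}
    (hb : ∀ i, eigenvector A i = b i) (r i : Fin p) :
    scaling A r (b i) = (if i < r then (eigenvalue A i)⁻¹ else (eigenvalue A r)⁻¹) • b i := by
  simp only [scaling, add_apply, smul_apply, ContinuousLinearMap.id_apply, sum_apply, hb,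
    InnerProductSpace.rankOne_apply, b.inner_eq_ite, ite_smul, one_smul, zero_smul, smul_ite,
    smul_zero]
  rw [Finset.sum_ite_eq']
  simp only [Finset.mem_Iio]
  split_ifs
  · rw [← add_smul, add_sub_cancel]
  · rw [add_zero]

theorem norm_scaling_apply_le (hA : (A : Param p →ₗ[ℝ] Param p).IsSymmetric) {r : Fin p}
    (hr : 0 < eigenvalue A r) (v : Param p) :
    ‖scaling A r v‖ ≤ (eigenvalue A r)⁻¹ * ‖v‖ := by
  obtain ⟨b, hb, -⟩ := exists_eigenbasis hA
  refine norm_apply_le_of_eigenbasis b (scaling_apply_eigenbasis hb r) (by positivity)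
    (fun i => ?_) v
  split_ifs with h
  · have := eigenvalue_antitone hA h.le
    rw [abs_of_pos (inv_pos.2 (hr.trans_le this))]
    exact inv_anti₀ hr this
  · rw [abs_of_pos (inv_pos.2 hr)]

/-- `I - QA` is diagonal in the eigenbasis of `A`: zero on the leading `r` vectors, `1 - λᵢ/λ_{r+1}`
on the rest. These entries lie in `[0, 1]` up to the largest one, attained at the last index `q`. -/
theorem norm_sub_scaling_apply_le (hA : (A : Param p →ₗ[ℝ] Param p).IsSymmetric) {r : Fin p}
    (hr : 0 < eigenvalue A r) {q : Fin p} (hq : ∀ i, i ≤ q) (v : Param p) :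
    ‖v - scaling A r (A v)‖ ≤ (1 - eigenvalue A q / eigenvalue A r) * ‖v‖ := by
  obtain ⟨b, hb, hAb⟩ := exists_eigenbasis hA
  have hanti := eigenvalue_antitone hA
  have hqr : 0 ≤ 1 - eigenvalue A q / eigenvalue A r := by
    rw [sub_nonneg, div_le_one hr]
    exact hanti (hq r)
  have hdiag : ∀ i, (ContinuousLinearMap.id ℝ (Param p) - (scaling A r).comp A) (b i) =
      (if i < r then 0 else 1 - eigenvalue A i / eigenvalue A r) • b i := by
    intro i
    rw [sub_apply, ContinuousLinearMap.id_apply, ContinuousLinearMap.comp_apply, hAb, map_smul,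
      scaling_apply_eigenbasis hb, smul_smul]
    split_ifs with h
    · rw [mul_inv_cancel₀ (hr.trans_le (hanti h.le)).ne', one_smul, sub_self, zero_smul]
    · rw [sub_smul, one_smul, div_eq_mul_inv]
  have hbound : ∀ i, |if i < r then 0 else 1 - eigenvalue A i / eigenvalue A r| ≤
      1 - eigenvalue A q / eigenvalue A r := by
    intro i
    split_ifs with h
    · rwa [abs_zero]
    · have h1 : eigenvalue A i / eigenvalue A r ≤ 1 := by
        rw [div_le_one hr]
        exact hanti (not_lt.1 h)
      have h2 : eigenvalue A q / eigenvalue A r ≤ eigenvalue A i / eigenvalue A r :=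
        div_le_div_of_nonneg_right (hanti (hq i)) hr.le
      rw [abs_of_nonneg (by linarith)]
      linarith
  have := norm_apply_le_of_eigenbasis b hdiag hqr hbound v
  rwa [sub_apply, ContinuousLinearMap.id_apply, ContinuousLinearMap.comp_apply] at this

end Scaling

/-! ### Taylor remainder and one step for the generalized linear model -/

/-- Taylor's formula with Lipschitz derivative. -/
theorem abs_sub_sub_deriv_mul_le {g : ℝ → ℝ} (hg : Differentiable ℝ g) {L : ℝ≥0}
    (hL : LipschitzWith L (deriv g)) (a b : ℝ) :
    |g a - g b - deriv g a * (a - b)| ≤ L / 2 * (a - b) ^ 2 := by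
  set δ := b - a with hδ
  have hlin : ∀ u : ℝ, HasDerivAt (fun u : ℝ => a + u * δ) δ u := fun u => by
    simpa using ((hasDerivAt_id u).mul_const δ).const_add a
  have hf : ∀ u : ℝ, HasDerivAt (fun u : ℝ => g (a + u * δ) - g a - u * (deriv g a * δ))
      (deriv g (a + u * δ) * δ - deriv g a * δ) u := fun u => by
    have := ((hg (a + u * δ)).hasDerivAt.comp u (hlin u)).sub_const (g a)
    simpa using this.fun_sub ((hasDerivAt_id u).mul_const (deriv g a * δ))
  have hB : ∀ u : ℝ, HasDerivAt (fun u : ℝ => L / 2 * δ ^ 2 * u ^ 2) (L * δ ^ 2 * u) u := fun u =>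
    ((hasDerivAt_pow 2 u).const_mul (L / 2 * δ ^ 2 : ℝ)).congr_deriv (by norm_num; ring)
  -- On the segment from `a` to `b`, the derivative of the remainder is dominated by that of `L/2 ·
  -- δ² u²`; both functions vanish at `u = 0`.
  have := image_norm_le_of_norm_deriv_right_le_deriv_boundary (a := (0 : ℝ)) (b := 1)
    (fun u _ => (hf u).continuousAt.continuousWithinAt) (fun u _ => (hf u).hasDerivWithinAt)
    (B := fun u => L / 2 * δ ^ 2 * u ^ 2) (by simp) hB (fun u hu => by
      have h := hL.norm_sub_le (a + u * δ) a
      rw [← sub_mul, norm_mul]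
      simp only [add_sub_cancel_left, norm_mul, Real.norm_eq_abs, abs_of_nonneg hu.1] at h
      calc _ ≤ L * (u * |δ|) * |δ| := mul_le_mul_of_nonneg_right h (abs_nonneg _)
        _ = L * |δ| ^ 2 * u := by ring
        _ = L * δ ^ 2 * u := by rw [sq_abs])
    (Set.right_mem_Icc.2 zero_le_one)
  rw [Real.norm_eq_abs] at this
  rw [← abs_neg]
  have e1 : -(g a - g b - deriv g a * (a - b)) = g (a + 1 * δ) - g a - 1 * (deriv g a * δ) := by
    rw [one_mul, one_mul, hδ, add_sub_cancel]
    ring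
  rw [e1]
  refine this.trans_eq ?_
  rw [hδ]
  ring

section GLM

variable {p n : ℕ} {Φ : ℝ → ℝ} (x : Fin n → Param p) (y : Fin n → ℝ)

theorem gradient_glm (hΦ : Differentiable ℝ Φ) (i : Fin n) (θ : Param p) :
    HasGradientAt (glm Φ x y i) ((deriv Φ (inner ℝ (x i) θ) - y i) • x i) θ := by
  have h1 : HasFDerivAt (fun θ : Param p => inner ℝ (x i) θ) (innerSL ℝ (x i)) θ :=
    (innerSL ℝ (x i)).hasFDerivAt
  rw [hasGradientAt_iff_hasFDerivAt]
  refine (((hΦ _).hasDerivAt.comp_hasFDerivAt θ h1).sub (h1.const_mul (y i))).congr_fderiv ?_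
  ext v
  simp [sub_mul]

theorem hessian_glm (hΦ : Differentiable ℝ Φ) (hΦ' : Differentiable ℝ (deriv Φ)) (i : Fin n)
    (θ : Param p) :
    hessian (glm Φ x y i) θ =
      deriv (deriv Φ) (inner ℝ (x i) θ) • InnerProductSpace.rankOne ℝ (x i) (x i) := by
  rw [hessian, gradient_eq (gradient_glm x y hΦ i)]
  have h1 : HasFDerivAt (fun θ : Param p => inner ℝ (x i) θ) (innerSL ℝ (x i)) θ :=
    (innerSL ℝ (x i)).hasFDerivAt
  refine (HasFDerivAt.congr_fderiv ((((hΦ' _).hasDerivAt.comp_hasFDerivAt θ h1).sub_const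
    (y i)).smul_const (x i)) ?_).fderiv
  ext v
  simp [mul_assoc]

theorem gradient_average_glm (hΦ : Differentiable ℝ Φ) (θ : Param p) :
    ∇ (average (glm Φ x y)) θ =
      (1 / (n : ℝ)) • ∑ i, (deriv Φ (inner ℝ (x i) θ) - y i) • x i := by
  refine HasGradientAt.gradient ?_
  rw [hasGradientAt_iff_hasFDerivAt]
  refine ((HasFDerivAt.fun_sum fun i _ =>
    (gradient_glm x y hΦ i θ).hasFDerivAt).const_mul (1 / (n : ℝ))).congr_fderiv ?_
  simp

theorem isSymmetric_hessian_glm (hΦ : Differentiable ℝ Φ) (hΦ' : Differentiable ℝ (deriv Φ))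
    (i : Fin n) (θ : Param p) :
    ((hessian (glm Φ x y i) θ : Param p →L[ℝ] Param p) :
      Param p →ₗ[ℝ] Param p).IsSymmetric := by
  intro v w
  rw [hessian_glm x y hΦ hΦ']
  simp only [ContinuousLinearMap.coe_coe, smul_apply, InnerProductSpace.rankOne_apply,
    inner_smul_left, inner_smul_right, conj_trivial, real_inner_comm (x i) v]
  ring

theorem isSymmetric_subHessian_glm (hΦ : Differentiable ℝ Φ) (hΦ' : Differentiable ℝ (deriv Φ))
    {m : ℕ} (s : Fin m → Fin n) (θ : Param p) :
    ((subHessian (glm Φ x y) s θ : Param p →L[ℝ] Param p) :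
      Param p →ₗ[ℝ] Param p).IsSymmetric := by
  intro v w
  have := isSymmetric_sum Finset.univ
    (fun j _ => isSymmetric_hessian_glm x y hΦ hΦ' (s j) θ) v w
  rw [ContinuousLinearMap.coe_coe] at this ⊢
  rw [subHessian, smul_apply, smul_apply, inner_smul_left, inner_smul_right, this]
  simp

variable {x} {R : ℝ}

theorem norm_hessian_glm_apply_le (hΦ : Differentiable ℝ Φ)
    (hΦ' : Differentiable ℝ (deriv Φ)) (hΦ'' : ∀ z, |deriv (deriv Φ) z| ≤ 1) (hR : 0 ≤ R)
    (hx : ∀ i, ‖x i‖ ≤ Real.sqrt R) (i : Fin n) (θ v : Param p) :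
    ‖hessian (glm Φ x y i) θ v‖ ≤ R * ‖v‖ := by
  rw [hessian_glm x y hΦ hΦ', smul_apply, InnerProductSpace.rankOne_apply, norm_smul, norm_smul]
  calc _ ≤ 1 * (‖x i‖ * ‖v‖ * ‖x i‖) := by
        gcongr
        · exact hΦ'' _
        · exact norm_inner_le_norm _ _
    _ = ‖x i‖ ^ 2 * ‖v‖ := by ring
    _ ≤ Real.sqrt R ^ 2 * ‖v‖ := by gcongr; exact hx i
    _ = R * ‖v‖ := by rw [Real.sq_sqrt hR]

/-- Each term depends on `θ` only through `⟨x i, θ⟩`, so the one-dimensional Taylor formula for `Φ'`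
suffices. Of the three factors `‖x i‖` behind `R^(3/2)`, two come from the squared inner product and
one from the direction `x i`. -/
theorem norm_gradient_sub_gradient_sub_hessian_le (hΦ : Differentiable ℝ Φ)
    (hΦ' : Differentiable ℝ (deriv Φ)) {L : ℝ≥0} (hL : LipschitzWith L (deriv (deriv Φ)))
    (hR : 0 ≤ R) (hx : ∀ i, ‖x i‖ ≤ Real.sqrt R) (θ θ' : Param p) :
    ‖∇ (average (glm Φ x y)) θ - ∇ (average (glm Φ x y)) θ' -
      ((1 / (n : ℝ)) • ∑ i, hessian (glm Φ x y i) θ) (θ - θ')‖ ≤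
      L / 2 * R ^ (3 / 2 : ℝ) * ‖θ - θ'‖ ^ 2 := by
  have hR32 : R ^ (3 / 2 : ℝ) = Real.sqrt R ^ 3 := by
    rw [Real.sqrt_eq_rpow, ← Real.rpow_natCast, ← Real.rpow_mul hR]
    norm_num
  have hterm : ∀ i, ‖(deriv Φ (inner ℝ (x i) θ) - y i) • x i -
      (deriv Φ (inner ℝ (x i) θ') - y i) • x i - hessian (glm Φ x y i) θ (θ - θ')‖ ≤
      L / 2 * R ^ (3 / 2 : ℝ) * ‖θ - θ'‖ ^ 2 := by
    intro i
    rw [hessian_glm x y hΦ hΦ', smul_apply, InnerProductSpace.rankOne_apply, smul_smul,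
      ← sub_smul, ← sub_smul, norm_smul, inner_sub_right, sub_sub_sub_cancel_right,
      Real.norm_eq_abs]
    have h1 := abs_sub_sub_deriv_mul_le hΦ' hL (inner ℝ (x i) θ) (inner ℝ (x i) θ')
    have h2 : (inner ℝ (x i) θ - inner ℝ (x i) θ') ^ 2 ≤ (‖x i‖ * ‖θ - θ'‖) ^ 2 := by
      rw [← inner_sub_right]
      exact sq_le_sq' (neg_le_of_abs_le (abs_real_inner_le_norm _ _))
        (real_inner_le_norm _ _)
    calc _ ≤ (L / 2 * (‖x i‖ * ‖θ - θ'‖) ^ 2) * ‖x i‖ :=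
          mul_le_mul_of_nonneg_right
            (h1.trans (mul_le_mul_of_nonneg_left h2 (by positivity))) (norm_nonneg _)
      _ = L / 2 * ‖x i‖ ^ 3 * ‖θ - θ'‖ ^ 2 := by ring
      _ ≤ L / 2 * Real.sqrt R ^ 3 * ‖θ - θ'‖ ^ 2 := by gcongr; exact hx i
      _ = _ := by rw [hR32]
  rw [gradient_average_glm x y hΦ, gradient_average_glm x y hΦ, smul_apply, sum_apply, ← smul_sub,
    ← smul_sub, ← Finset.sum_sub_distrib, ← Finset.sum_sub_distrib, norm_smul]
  rcases Nat.eq_zero_or_pos n with rfl | hn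
  · simpa using by positivity
  have hn' : (0 : ℝ) < n := by exact_mod_cast hn
  rw [Real.norm_of_nonneg (by positivity), one_div, inv_mul_le_iff₀ hn']
  refine (norm_sum_le_of_le _ fun i _ => hterm i).trans_eq ?_
  simp

/-- One step with unit step size, when the sub-sampled Hessian is `ε`-close to the Hessian. -/
theorem norm_step_sub_le (hΦ : Differentiable ℝ Φ)
    (hΦ' : Differentiable ℝ (deriv Φ)) {L : ℝ≥0} (hL : LipschitzWith L (deriv (deriv Φ)))
    (hR : 0 ≤ R) (hx : ∀ i, ‖x i‖ ≤ Real.sqrt R) {C : Set (Param p)} (hconv : Convex ℝ C)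
    (hC : IsClosed C) {θs : Param p} (hθs : θs ∈ C)
    (hmin : ∀ θ', average (glm Φ x y) θs ≤ average (glm Φ x y) θ') {r q : Fin p}
    (hq : ∀ i, i ≤ q) {m : ℕ} {s : Fin m → Fin n} {θ : Param p}
    (hr : 0 < eigenvalue (subHessian (glm Φ x y) s θ) r) {ε : ℝ}
    (hε : ∀ v, ‖(subHessian (glm Φ x y) s θ -
      (1 / (n : ℝ)) • ∑ i, hessian (glm Φ x y i) θ) v‖ ≤ ε * ‖v‖) :
    ‖step (glm Φ x y) C r 1 s θ - θs‖ ≤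
      (1 - eigenvalue (subHessian (glm Φ x y) s θ) q / eigenvalue (subHessian (glm Φ x y) s θ) r +
        ε / eigenvalue (subHessian (glm Φ x y) s θ) r) * ‖θ - θs‖ +
      L * R ^ (3 / 2 : ℝ) / (2 * eigenvalue (subHessian (glm Φ x y) s θ) r) * ‖θ - θs‖ ^ 2 := by
  rw [step, if_pos hr, one_smul]
  have hA := isSymmetric_subHessian_glm x y hΦ hΦ' s θ
  set A := subHessian (glm Φ x y) s θ
  set H := (1 / (n : ℝ)) • ∑ i, hessian (glm Φ x y i) θ with hH
  refine (norm_proj_sub_le hconv hC hθs _).trans ?_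
  -- Minimality over the whole space, not merely over `C`, makes the gradient vanish.
  have hgrad : ∇ (average (glm Φ x y)) θs = 0 := by
    have : IsLocalMin (average (glm Φ x y)) θs := Filter.Eventually.of_forall hmin
    rw [gradient, this.fderiv_eq_zero, map_zero]
  have hrem := norm_gradient_sub_gradient_sub_hessian_le y hΦ hΦ' hL hR hx θ θs
  rw [hgrad, sub_zero, ← hH] at hrem
  set g := ∇ (average (glm Φ x y)) θ
  have hsplit : θ - scaling A r g - θs = ((θ - θs) - scaling A r (A (θ - θs))) +
      scaling A r ((A - H) (θ - θs)) - scaling A r (g - H (θ - θs)) := by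
    simp only [sub_apply, map_sub]
    abel
  rw [hsplit]
  have h1 := norm_sub_scaling_apply_le hA hr hq (θ - θs)
  have h2 := (norm_scaling_apply_le hA hr ((A - H) (θ - θs))).trans
    (mul_le_mul_of_nonneg_left (hε _) (inv_pos.2 hr).le)
  have h3 := (norm_scaling_apply_le hA hr (g - H (θ - θs))).trans
    (mul_le_mul_of_nonneg_left hrem (inv_pos.2 hr).le)
  refine (norm_sub_le _ _).trans ((add_le_add (norm_add_le _ _) le_rfl).trans
    ((add_le_add (add_le_add h1 h2) h3).trans_eq ?_))
  have : eigenvalue A r ≠ 0 := hr.ne'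
  field_simp

end GLM

/-! ### Independence and conclusion -/

theorem iterate_congr {p n : ℕ} (f : Fin n → Param p → ℝ) (C : Set (Param p)) (r : Fin p)
    (η : ℕ → ℝ) {m : ℕ → ℕ} {s s' : (t : ℕ) → Fin (m t) → Fin n} (θ₀ : Param p) {t : ℕ}
    (h : ∀ k < t, s k = s' k) : iterate f C r η s θ₀ t = iterate f C r η s' θ₀ t := by
  induction t with
  | zero => rfl
  | succ t ih =>
    rw [iterate, iterate, h t t.lt_succ_self, ih fun k hk => h k (hk.trans t.lt_succ_self)]

/-- If `g` is a discrete variable independent of `S`, a bound for the probability of `S ∈ B h`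
uniform in `h` bounds the probability of `S ∈ B g`. -/
theorem measureReal_mem_le_of_indepFun {Ω α β : Type*} [MeasurableSpace Ω] {μ : Measure Ω}
    [IsProbabilityMeasure μ] [Fintype α] [MeasurableSpace α] [MeasurableSingletonClass α]
    [Finite β] [MeasurableSpace β] [MeasurableSingletonClass β] {g : Ω → α} {S : Ω → β}
    (hg : Measurable g) (hind : IndepFun g S μ) (B : α → Set β) {q : ℝ}
    (hB : ∀ a, μ.real (S ⁻¹' B a) ≤ q) : μ.real {ω | S ω ∈ B (g ω)} ≤ q := by
  -- Conditioning on the finitely many values of `g`.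
  have h1 : {ω | S ω ∈ B (g ω)} = ⋃ a, g ⁻¹' {a} ∩ S ⁻¹' B a := by
    ext ω
    simp
  have h2 : ∀ a, μ.real (g ⁻¹' {a} ∩ S ⁻¹' B a) ≤ μ.real (g ⁻¹' {a}) * q := by
    intro a
    rw [measureReal_def, hind.measure_inter_preimage_eq_mul _ _ (measurableSet_singleton a)
      (B a).toFinite.measurableSet, ENNReal.toReal_mul]
    exact mul_le_mul_of_nonneg_left (hB a) measureReal_nonneg
  rw [h1]
  refine (measureReal_iUnion_fintype_le _).trans ((Finset.sum_le_sum fun a _ => h2 a).trans_eq ?_)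
  rw [← Finset.sum_mul]
  have h3 : ∑ a, μ.real (g ⁻¹' {a}) = 1 := by
    have := sum_measureReal_preimage_singleton (μ := μ) (f := g) Finset.univ
      (fun a _ => hg (measurableSet_singleton a))
    rw [this]
    simp
  rw [h3, one_mul]

end NewSamp

theorem corollary4 :
    ∃ c : ℝ, 0 < c ∧
      ∀ (p n : ℕ) (Φ : ℝ → ℝ) (x : Fin n → NewSamp.Param p) (y : Fin n → ℝ) (L : ℝ≥0) (R : ℝ)
        (C : Set (NewSamp.Param p)) (θ₀ θs : NewSamp.Param p) (r : ℕ) (hr : r < p)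
        (m : ℕ → ℕ) (Ω : Type*) [MeasurableSpace Ω] (μ : Measure Ω) [IsProbabilityMeasure μ]
        (S : (t : ℕ) → Ω → Fin (m t) → Fin n) (θ : ℕ → Ω → NewSamp.Param p)
        (ev : ℕ → Ω → Fin p → ℝ) (ξ₁ ξ₂ : ℕ → Ω → ℝ),
        -- the cumulant generating function
        ContDiff ℝ 2 Φ →
        (∀ z, 0 ≤ deriv (deriv Φ) z ∧ deriv (deriv Φ) z ≤ 1) →
        LipschitzWith L (deriv (deriv Φ)) →
        -- the covariates
        0 ≤ R →
        (∀ i, ‖x i‖ ≤ Real.sqrt R) →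
        -- the parameter set and the minimizer
        Convex ℝ C → IsClosed C →
        θs ∈ C →
        (∀ θ', NewSamp.average (NewSamp.glm Φ x y) θs ≤ NewSamp.average (NewSamp.glm Φ x y) θ') →
        -- the sub-samples
        (∀ t, 0 < m t) →
        NewSamp.IsUniformSubsampling μ S →
        -- `θ t` is the iterate at step `t`, with all step sizes equal to `1`
        (∀ t ω, θ t ω = NewSamp.iterate (NewSamp.glm Φ x y) C ⟨r, hr⟩ (fun _ => 1)
          (fun k => S k ω) θ₀ t) →
        -- `ev t` are the eigenvalues of the sub-sampled Hessian at step `t`: the `i`-th largest one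
        -- has index `i - 1`
        (∀ t ω i, ev t ω i =
          NewSamp.eigenvalue (NewSamp.subHessian (NewSamp.glm Φ x y) (S t ω) (θ t ω)) i) →
        -- the coefficients
        (∀ t ω, ξ₁ t ω = 1 - ev t ω ⟨p - 1, by omega⟩ / ev t ω ⟨r, hr⟩
          + c * R / ev t ω ⟨r, hr⟩ * Real.sqrt (Real.log p / m t)) →
        (∀ t ω, ξ₂ t ω = L * R ^ (3 / 2 : ℝ) / (2 * ev t ω ⟨r, hr⟩)) →
        ∀ t : ℕ,
          1 - 2 / (p : ℝ) ≤
            μ.real {ω | 0 < ev t ω ⟨r, hr⟩ →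
              ‖θ (t + 1) ω - θs‖ ≤ ξ₁ t ω * ‖θ t ω - θs‖ + ξ₂ t ω * ‖θ t ω - θs‖ ^ 2} := by

  refine ⟨4, by norm_num, ?_⟩
  intro p n Φ x y L R C θ₀ θs r hr m Ω _ μ _ S θ ev ξ₁ ξ₂ hΦ hΦ'' hL hR hx hconv hC hθs hmin hm hS
    hθ hev hξ₁ hξ₂ t
  have hp : 0 < p := by omega
  have hd1 : Differentiable ℝ Φ := hΦ.differentiable (by norm_num)
  have hd2 : Differentiable ℝ (deriv Φ) :=
    (contDiff_succ_iff_deriv.1 (one_add_one_eq_two (R := WithTop ℕ∞) ▸ hΦ)).2.2.differentiable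
      one_ne_zero
  have hΦabs : ∀ z, |deriv (deriv Φ) z| ≤ 1 := fun z => by
    rw [abs_of_nonneg (hΦ'' z).1]
    exact (hΦ'' z).2
  -- A nonempty sample exists, so there is at least one index.
  have hn : 0 < n := by
    obtain ⟨ω⟩ : Nonempty Ω := μ.nonempty_of_neZero
    exact (S 0 ω ⟨0, hm 0⟩).pos
  set ε : ℝ := 4 * R * Real.sqrt (Real.log p / m t) with hε
  set f := NewSamp.glm Φ x y
  -- the samples for which the sub-sampled Hessian at a fixed point is far from the Hessian
  set bad : NewSamp.Param p → Set (Fin (m t) → Fin n) := fun θ' => {s | ¬∀ v,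
    ‖(NewSamp.subHessian f s θ' - (1 / (n : ℝ)) • ∑ i, NewSamp.hessian (f i) θ') v‖ ≤ ε * ‖v‖}
    with hbad
  have hprob : μ.real {ω | S t ω ∈ bad (θ t ω)} ≤ 2 / p := by
    have hYs := fun θ' i => NewSamp.isSymmetric_hessian_glm x y hd1 hd2 i θ'
    have hY := fun θ' i v => NewSamp.norm_hessian_glm_apply_le y hd1 hd2 hΦabs hR hx i θ' v
    have htail : ∀ θ', μ.real (S t ⁻¹' bad θ') ≤ 2 / p := by
      intro θ'
      -- The tail bound needs `R > 0`; for `R = 0` all Hessians vanish and no sample is bad.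
      rcases hR.eq_or_lt with rfl | hR'
      · have : bad θ' = ∅ := by
          ext s
          have h0 : ∀ i, NewSamp.hessian (f i) θ' = 0 := fun i => by
            ext1 v
            simpa using hY θ' i v
          simp [hbad, hε, NewSamp.subHessian, h0]
        rw [this, Set.preimage_empty, measureReal_empty]
        positivity
      · rw [← map_measureReal_apply (hS.measurable t) (bad θ').toFinite.measurableSet]
        exact NewSamp.uniformOn_real_not_norm_average_sub_average_le hp (hm t) hn (hS.uniform t)
          (hYs θ') hR' (hY θ')
    have hind := hS.independent.indepFun_finset (Finset.range t) {t} (by simp) hS.measurable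
    have hind' : IndepFun (fun ω (k : Finset.range t) => S k ω) (S t) μ :=
      hind.comp measurable_id (measurable_pi_apply (⟨t, by simp⟩ : ({t} : Finset ℕ)))
    have hmeas : Measurable fun ω (k : Finset.range t) => S k ω :=
      measurable_pi_lambda _ fun k => hS.measurable k
    -- the current iterate as a function of the previous samples
    set G : ((k : Finset.range t) → Fin (m k) → Fin n) → NewSamp.Param p := fun h =>
      NewSamp.iterate f C ⟨r, hr⟩ (fun _ => 1)
        -- Samples from time `t` on are filled with a dummy, which iterate `t` never reads.
        (fun k => if hk : k ∈ Finset.range t then h ⟨k, hk⟩ else fun _ => ⟨0, hn⟩) θ₀ t with hG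
    have hθG : ∀ ω, θ t ω = G fun k => S k ω := by
      intro ω
      rw [hθ, hG]
      refine NewSamp.iterate_congr _ _ _ _ _ fun k hk => ?_
      rw [dif_pos (Finset.mem_range.2 hk)]
    simp only [hθG]
    exact NewSamp.measureReal_mem_le_of_indepFun hmeas hind' (fun h => bad (G h))
      fun h => htail _
  -- The good and bad events cover `Ω`; subadditivity bounds the good one from below without proving
  -- it measurable.
  have hcompl : μ.real Set.univ ≤ μ.real {ω | 0 < ev t ω ⟨r, hr⟩ →
      ‖θ (t + 1) ω - θs‖ ≤ ξ₁ t ω * ‖θ t ω - θs‖ + ξ₂ t ω * ‖θ t ω - θs‖ ^ 2} +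
      μ.real {ω | S t ω ∈ bad (θ t ω)} := by
    refine (measureReal_mono (fun ω _ => ?_)).trans (measureReal_union_le _ _)
    by_cases hω : S t ω ∈ bad (θ t ω)
    · exact Or.inr hω
    · refine Or.inl fun hpos => ?_
      rw [hev] at hpos
      have hstep : θ (t + 1) ω =
          NewSamp.step f C ⟨r, hr⟩ 1 (S t ω) (θ t ω) := by
        rw [hθ, hθ, NewSamp.iterate]
      have := NewSamp.norm_step_sub_le y hd1 hd2 hL hR hx hconv hC hθs hmin
        (q := ⟨p - 1, by omega⟩) (fun i => Fin.le_def.2 (by simp; omega)) hpos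
        (not_not.1 hω)
      rw [hstep, hξ₁, hξ₂, hev, hev]
      refine this.trans_eq ?_
      rw [hε]
      ring
  rw [probReal_univ] at hcompl
  linarith
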